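/- Consider a reactive power compensation game with a finite set $\mathcal N$ of $N$ customers. Customer $i$ has active power $p_i>0$, initial power factor $\phi_i>0$, standard power factor $\widetilde\phi_i\in(0,1]$, penalty factor $\tau_i\in[0,1]$, and a finite non-empty action set $\mathcal A_i\subset(\phi_i,1]$ of reachable power factors. For a vector $a\in\prod_{j}(0,1]$ of power factors put $$q_i^c(a_i)=p_i\frac{\sqrt{1-\phi_i^2}}{\phi_i}-p_i\frac{\sqrt{1-a_i^2}}{a_i},\qquad \widetilde q_i^c=q_i^c(\widetilde\phi_i),\qquad E_i(a)=q_i^c(a_i)-\frac1N\sum_{j\in\mathcal N}q_j^c(a_j),$$ and let $u_i(a)=B_i(a)-C_i(a)$, where, writing $(T)$ for the condition $\sum_{j}q_j^c(a_j)\ge\sum_{j}\widetilde q_j^c$, $$B_i(a)=\begin{cases}E_i(a)&\text{if }a_i\ge\widetilde\phi_i\text{ and }(T),\\0&\text{otherwise,}\end{cases}\qquad C_i(a)=\begin{cases}\tau_i\max\{0,q_i^c(a_i)-\widetilde q_i^c\}&\text{if }a_i\ge\widetilde\phi_i\text{ and }(T),\\-E_i(a)&\text{if }a_i<\widetilde\phi_i\text{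 and }(T),\\q_i^c(a_i)&\text{otherwise.}\end{cases}$$ Let $\alpha_i,\beta_i\in(0,1]$, $k_i>0$, let $a^0\in\prod_j(0,1]$ be a reference vector of power factors, and let the prospect-theoretic framed utilities be $$u_i^{\mathrm{PT}}(a)=\begin{cases}\bigl(u_i(a)-u_i(a^0)\bigr)^{\alpha_i}&\text{if }u_i(a)\ge u_i(a^0),\\-k_i\bigl(u_i(a^0)-u_i(a)\bigr)^{\beta_i}&\text{otherwise.}\end{cases}$$ For a profile $\sigma=(\sigma_i)_{i\in\mathcal N}$ of mixed strategies, $\sigma_i$ being a probability distribution on $\mathcal A_i$, let $$U_i^{\mathrm{PT}}(\sigma)=\sum_{a\in\prod_j\mathcal A_j}\Bigl(\prod_{j\in\mathcal N}\sigma_j(a_j)\Bigr)u_i^{\mathrm{PT}}(a).$$ Then the game has at least one mixed-strategy Nash equilibrium under prospect theory: there is a profile $\sigma^*$ of mixed strategies such that $U_i^{\mathrm{PT}}(\sigma_i^*,\sigma_{-i}^*)\ge U_i^{\mathrm{PT}}(\sigma_i,\sigma_{-i}^*)$ for every customer $i$ and every mixed strategy $\sigma_i$ on $\mathcal A_i$.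 -/

import Mathlib

/-- The data of a reactive power compensation game among the customers `ι`. -/
structure VarGame (ι : Type*) where
  /-- active power required by a customer -/
  p : ι → ℝ
  /-- initial power factor (before any compensation) -/
  pf : ι → ℝ
  /-- standard power factor announced by the power company -/
  pfStd : ι → ℝ
  /-- penalty factor for over-compensation -/
  pen : ι → ℝ
  /-- the discrete (finite) set of actions, i.e. of power factors the customer can reach -/
  A : ι → Finset ℝ
  p_pos : ∀ i, 0 < p i
  pf_pos : ∀ i, 0 < pf i
  pfStd_mem : ∀ i, pfStd i ∈ Set.Ioc (0 : ℝ) 1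
  pen_mem : ∀ i, pen i ∈ Set.Icc (0 : ℝ) 1
  A_nonempty : ∀ i, (A i).Nonempty
  A_subset : ∀ i, ∀ x ∈ A i, x ∈ Set.Ioc (pf i) 1

/-- The parameters of the prospect-theoretic framing: gain and loss distortions `α`, `β`,
aversion parameter `k`, and the vector `a₀` of power factors at which the reference utility of
every customer is taken (it need not consist of available actions; the vector of standard power
factors is allowed). -/
structure PTFraming (ι : Type*) where
  α : ι → ℝ
  β : ι → ℝ
  k : ι → ℝ
  a₀ : ι → ℝ
  α_mem : ∀ i, α i ∈ Set.Ioc (0 : ℝ) 1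
  β_mem : ∀ i, β i ∈ Set.Ioc (0 : ℝ) 1
  k_pos : ∀ i, 0 < k i
  a₀_mem : ∀ i, a₀ i ∈ Set.Ioc (0 : ℝ) 1

/-- The tangent of the phase angle whose cosine is `x`. -/
noncomputable def pfTan (x : ℝ) : ℝ := Real.sqrt (1 - x ^ 2) / x

namespace VarGame

variable {ι : Type*} [Fintype ι] (G : VarGame ι)

/-- Var value `q_i^c(x)` of customer `i` that moves from its initial power factor to `x`. -/
noncomputable def q (i : ι) (x : ℝ) : ℝ :=
  G.p i * pfTan (G.pf i) - G.p i * pfTan x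

/-- Compensation required from customer `i` by the power company. -/
noncomputable def qStd (i : ι) : ℝ :=
  G.p i * pfTan (G.pf i) - G.p i * pfTan (G.pfStd i)

/-- Var exchange: difference between customer `i`'s compensation and the average one. -/
noncomputable def exchange (i : ι) (a : ι → ℝ) : ℝ :=
  G.q i (a i) - (∑ j, G.q j (a j)) / (Fintype.card ι : ℝ)

/-- The total compensation meets the total requirement. -/
def TotalMet (a : ι → ℝ) : Prop :=
  ∑ j, G.q j (a j) ≥ ∑ j, G.qStd j

open Classical in
/-- Var benefit `B_i`. -/
noncomputable def benefit (i : ι) (a : ι → ℝ) : ℝ :=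
  if a i ≥ G.pfStd i ∧ G.TotalMet a then G.exchange i a else 0

open Classical in
/-- Var cost `C_i`. -/
noncomputable def cost (i : ι) (a : ι → ℝ) : ℝ :=
  if a i ≥ G.pfStd i ∧ G.TotalMet a then G.pen i * max 0 (G.q i (a i) - G.qStd i)
  else if a i < G.pfStd i ∧ G.TotalMet a then - G.exchange i a
  else G.q i (a i)

/-- The objective utility `u_i = B_i - C_i` of a vector of power factors. -/
noncomputable def utility (i : ι) (a : ι → ℝ) : ℝ := G.benefit i a - G.cost i a

open Classical in
/-- The prospect-theoretic framed utility of customer `i`, relative to its reference utility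
`u_i(a₀)`. -/
noncomputable def ptUtility (F : PTFraming ι) (i : ι) (a : ι → ℝ) : ℝ :=
  if G.utility i a ≥ G.utility i F.a₀ then
    (G.utility i a - G.utility i F.a₀) ^ (F.α i)
  else
    - F.k i * (G.utility i F.a₀ - G.utility i a) ^ (F.β i)

/-- A mixed strategy profile: a probability vector on the action set of every customer. -/
def IsMixedProfile (σ : ∀ i, G.A i → ℝ) : Prop :=
  ∀ i, σ i ∈ stdSimplex ℝ (G.A i)

variable [DecidableEq ι]

/-- Expected value of the pure payoff `u` when customers randomize independently by `σ`. -/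
noncomputable def expected (u : (ι → ℝ) → ℝ) (σ : ∀ i, G.A i → ℝ) : ℝ :=
  ∑ a : (∀ j, G.A j), (∏ j, σ j (a j)) * u (fun j => (a j : ℝ))

/-- Expected utility of customer `i` under framing. -/
noncomputable def expectedPT (F : PTFraming ι) (i : ι) (σ : ∀ i, G.A i → ℝ) : ℝ :=
  G.expected (G.ptUtility F i) σ

/-- Mixed-strategy Nash equilibrium for expected utilities `U`: a mixed strategy profile from
which no customer gains by deviating unilaterally to another mixed strategy. -/
def IsMixedNash (U : ι → (∀ i, G.A i → ℝ) → ℝ) (σ : ∀ i, G.A i → ℝ) : Prop :=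
  G.IsMixedProfile σ ∧
    ∀ i, ∀ ρ ∈ stdSimplex ℝ (G.A i), U i (Function.update σ i ρ) ≤ U i σ

end VarGame

/-! Framing changes only the payoffs: action sets stay finite and expected utility stays linear in
each customer's own probabilities. So the claim is Nash's theorem for arbitrary real payoffs,
`exists_mixed_equilibrium`.

Nash's theorem comes from a covering theorem on a single simplex whose vertices are all pairs
(player, action). To (i, a) attach the closed set of points where i has least total mass and a is a
best reply of i. By `exists_mem_stdSimplex_forall_pos_mem` some point lies in every set whose
coordinate is positive there. Minimality forces equal masses, and rescaling gives a profile that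
plays only best replies.

The covering theorem is the limit of a grid version, obtained from Scarf's lemma. The latter is a
parity count of incidences between almost fully coloured sets and dominating sets, resting on the
pivot step `exists_pair_isDominating_insert`. -/

section Scarf

/-! ### Scarf's lemma: dominating sets for several linear orders. -/

variable {I V L : Type*} [LinearOrder L]

/-- No point of `V` is strictly above `X` for each of the orders induced by the `r i`. -/
def IsDominating (r : I → V → L) (X : Finset V) : Prop :=
  ∀ y, ∃ i, ∀ x ∈ X, r i y ≤ r i x

theorem IsDominating.subset {r : I → V → L} {X Y : Finset V} (h : IsDominating r X)
    (hYX : Y ⊆ X) : IsDominating r Y := fun y =>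
  let ⟨i, hi⟩ := h y
  ⟨i, fun x hx => hi x (hYX hx)⟩

variable [Fintype I] [DecidableEq I] [Fintype V] [DecidableEq V]

/-- Domination makes every point of `τ` the minimum for some order. There is one more order than
points, so exactly two orders `i`, `j` share their minimum. A new point must become the minimum for
one of these two, and is then the highest candidate in that order among the points above the old
minima of all the others. `hM` provides candidates. -/
theorem exists_pair_isDominating_insert {r : I → V → L} (hr : ∀ i, Function.Injective (r i))
    {τ : Finset V} (hne : τ.Nonempty) (hcard : τ.card + 1 = Fintype.card I)
    (hdom : IsDominating r τ)
    (hM : ∀ k, ∃ y, ∀ l, l ≠ k → ∃ x ∈ τ, r l x < r l y) :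
    ∃ a b, a ≠ b ∧ a ∉ τ ∧ b ∉ τ ∧
      ∀ y, y ∉ τ → (IsDominating r (insert y τ) ↔ y = a ∨ y = b) := by
  have hmin : ∀ l, ∃ x ∈ τ, ∀ x' ∈ τ, r l x ≤ r l x' := fun l => τ.exists_min_image (r l) hne
  choose m hmτ hmle using hmin
  have hsurj : ∀ x ∈ τ, ∃ l, m l = x := fun x hx => by
    obtain ⟨i, hi⟩ := hdom x
    exact ⟨i, hr i (le_antisymm (hmle i x hx) (hi _ (hmτ i)))⟩
  obtain ⟨i, -, j, -, hij, hmij⟩ : ∃ i ∈ (Finset.univ : Finset I), ∃ j ∈ Finset.univ,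
      i ≠ j ∧ m i = m j :=
    Finset.exists_ne_map_eq_of_card_lt_of_maps_to (t := τ)
      (by rw [Finset.card_univ]; omega) (fun l _ => hmτ l)
  have hattain : ∀ k, k = i ∨ k = j → ∀ x ∈ τ, ∃ l, l ≠ k ∧ m l = x := by
    intro k hk x hx
    obtain ⟨l, hl⟩ := hsurj x hx
    by_cases hlk : l = k
    · rcases hk with rfl | rfl
      · exact ⟨j, hij.symm, by rw [← hmij, ← hlk, hl]⟩
      · exact ⟨i, hij, by rw [hmij, ← hlk, hl]⟩
    · exact ⟨l, hlk, hl⟩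
  have hinj : ∀ k, k = i ∨ k = j → ∀ l, l ≠ k → ∀ l', l' ≠ k → m l = m l' → l = l' := by
    intro k hk l hl l' hl' h
    have : Set.InjOn m (Finset.univ.erase k : Finset I) := by
      refine Finset.injOn_of_surjOn_of_card_le (t := τ) m (fun l _ => hmτ l) ?_ ?_
      · intro x hx
        obtain ⟨l, hl, hlx⟩ := hattain k hk x hx
        exact ⟨l, by simpa using hl, hlx⟩
      · rw [Finset.card_erase_of_mem (Finset.mem_univ _), Finset.card_univ]; omega
    exact this (by simpa using hl) (by simpa using hl') h
  have hmax : ∀ k, ∃ a, (∀ l, l ≠ k → r l (m l) < r l a) ∧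
      ∀ y, (∀ l, l ≠ k → r l (m l) < r l y) → r k y ≤ r k a := by
    intro k
    obtain ⟨a, ha, hle⟩ := (Finset.univ.filter
      (fun y => ∀ l, l ≠ k → r l (m l) < r l y)).exists_max_image (r k) (by
        obtain ⟨y, hy⟩ := hM k
        refine ⟨y, by
          simp only [Finset.mem_filter, Finset.mem_univ, true_and]
          intro l hl
          obtain ⟨x, hx, hlt⟩ := hy l hl
          exact (hmle l x hx).trans_lt hlt⟩)
    simp only [Finset.mem_filter, Finset.mem_univ, true_and] at ha hle
    exact ⟨a, ha, hle⟩
  choose a haM hale using hmax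
  -- `a k` beats the minimum of every order other than `k`, so only `k` can witness domination at `a
  -- k`.
  have hbelow : ∀ k, ∀ x ∈ τ, r k (a k) ≤ r k x := by
    intro k
    obtain ⟨l, hl⟩ := hdom (a k)
    by_cases hlk : l = k
    · exact hlk ▸ hl
    · exact absurd (hl _ (hmτ l)) (not_le.mpr (haM k l hlk))
  have hnot : ∀ k, k = i ∨ k = j → a k ∉ τ := by
    intro k hk hmem
    obtain ⟨l, hl, hla⟩ := hattain k hk _ hmem
    have := haM k l hl
    rw [hla] at this
    exact lt_irrefl _ this
  have hdomk : ∀ k, IsDominating r (insert (a k) τ) := by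
    intro k y
    by_cases h : ∀ l, l ≠ k → r l (m l) < r l y
    · refine ⟨k, fun x hx => ?_⟩
      rcases Finset.mem_insert.mp hx with rfl | hx
      · exact hale k y h
      · exact (hale k y h).trans (hbelow k x hx)
    · push Not at h
      obtain ⟨l, hlk, hl⟩ := h
      refine ⟨l, fun x hx => ?_⟩
      rcases Finset.mem_insert.mp hx with rfl | hx
      · exact hl.trans (haM k l hlk).le
      · exact hl.trans (hmle l x hx)
  refine ⟨a i, a j, ?_, hnot i (Or.inl rfl), hnot j (Or.inr rfl), fun y hy => ⟨fun h => ?_, ?_⟩⟩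
  · intro h
    have h1 := haM i j hij.symm
    rw [h] at h1
    exact absurd (hbelow j _ (hmτ j)) (not_le.mpr h1)
  · obtain ⟨k, hk⟩ := h y
    have hklt : ∀ x ∈ τ, r k y < r k x := fun x hx =>
      lt_of_le_of_ne (hk x (Finset.mem_insert_of_mem hx)) fun h => hy (hr k h ▸ hx)
    have hother : ∀ x ∈ τ, ∃ l, l ≠ k ∧ m l = x ∧ r l (m l) < r l y := by
      intro x hx
      obtain ⟨l, hl⟩ := h x
      have hlx : m l = x := hr l
        (le_antisymm (hmle l x hx) (hl _ (Finset.mem_insert_of_mem (hmτ l))))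
      refine ⟨l, ?_, hlx, ?_⟩
      · rintro rfl
        exact absurd (hl y (Finset.mem_insert_self _ _)) (not_le.mpr (hklt x hx))
      · rw [hlx]
        exact lt_of_le_of_ne (hl y (Finset.mem_insert_self _ _)) fun h => hy (hr l h ▸ hx)
    -- Since `y` takes over order `k`, the point `m k` must be the minimum of a second order; only
    -- `i` and `j` share one.
    have hkij : k = i ∨ k = j := by
      by_contra! hcon
      obtain ⟨l, hlk, hlm, -⟩ := hother (m k) (hmτ k)
      by_cases hli : l = i
      · subst hli
        exact hcon.2 (hinj l (Or.inl rfl) k hcon.1 j hij.symm (hlm.symm.trans hmij))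
      · exact hlk (hinj i (Or.inl rfl) l hli k hcon.1 hlm)
    have hyM : ∀ l, l ≠ k → r l (m l) < r l y := by
      intro l hl
      obtain ⟨l', hl', hm, hlt⟩ := hother (m l) (hmτ l)
      exact hinj k hkij l' hl' l hl hm ▸ hlt
    have hya : y = a k := by
      refine hr k (le_antisymm (hale k y hyM) ?_)
      obtain ⟨l, hl⟩ := h (a k)
      by_cases hlk : l = k
      · exact hlk ▸ hl y (Finset.mem_insert_self _ _)
      · exact absurd (hl _ (Finset.mem_insert_of_mem (hmτ l))) (not_le.mpr (haM k l hlk))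
    exact hkij.imp (fun h : k = i => h ▸ hya) (fun h : k = j => h ▸ hya)
  · rintro (rfl | rfl)
    exacts [hdomk i, hdomk j]

omit [Fintype I] in
/-- A set which is one element larger than the set of colours it carries has exactly zero or two
subsets which are obtained by removing one point and carry the same colours. -/
theorem even_card_subset_image_eq {c : V → I} {D : Finset I} {X : Finset V}
    (hX : X.card = D.card + 1) (hc : ∀ x ∈ X, ∀ i, i ∉ D → c x = i → X.image c ≠ insert i D) :
    Even ((Finset.univ : Finset (Finset V)).filter
      (fun τ => (τ.card = D.card ∧ τ.image c = D) ∧ τ ⊆ X)).card := by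
  rcases Finset.eq_empty_or_nonempty ((Finset.univ : Finset (Finset V)).filter
      (fun τ => (τ.card = D.card ∧ τ.image c = D) ∧ τ ⊆ X)) with h | ⟨τ, hτ⟩
  · simp [h]
  simp only [Finset.mem_filter, Finset.mem_univ, true_and] at hτ
  obtain ⟨⟨hτc, hτD⟩, hτX⟩ := hτ
  obtain ⟨x, hx⟩ : ∃ x, X \ τ = {x} := by
    rw [← Finset.card_eq_one, Finset.card_sdiff_of_subset hτX]; omega
  have hxX : x ∈ X ∧ x ∉ τ := by
    rw [← Finset.mem_sdiff, hx]; simp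
  have hXτ : X = insert x τ := by
    rw [← Finset.sdiff_union_of_subset hτX, hx]; rfl
  have hcx : c x ∈ D := by
    by_contra hcon
    exact hc x hxX.1 _ hcon rfl (by rw [hXτ, Finset.image_insert, hτD])
  obtain ⟨x', hx'τ, hcx'⟩ : ∃ x' ∈ τ, c x' = c x := by
    rw [← hτD] at hcx
    simpa using hcx
  have hne : x ≠ x' := fun h => hxX.2 (h ▸ hx'τ)
  have hset : (Finset.univ : Finset (Finset V)).filter
      (fun τ => (τ.card = D.card ∧ τ.image c = D) ∧ τ ⊆ X) = {X.erase x, X.erase x'} := by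
    ext ρ
    simp only [Finset.mem_filter, Finset.mem_univ, true_and, Finset.mem_insert,
      Finset.mem_singleton]
    constructor
    · rintro ⟨⟨hρc, hρD⟩, hρX⟩
      have hinj : Set.InjOn c ρ := by
        rw [← Finset.card_image_iff, hρD, hρc]
      -- `x` and `x'` have the same colour, and `ρ` carries each colour once.
      have hout : x ∉ ρ ∨ x' ∉ ρ := by
        by_contra! h
        exact hne (hinj h.1 h.2 hcx'.symm)
      have key : ∀ z ∈ X, z ∉ ρ → ρ = X.erase z := fun z hz hzρ =>
        Finset.eq_of_subset_of_card_le
          (fun v hv => Finset.mem_erase.mpr ⟨fun h => hzρ (h ▸ hv), hρX hv⟩)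
          (by rw [Finset.card_erase_of_mem hz]; omega)
      exact hout.imp (key x hxX.1) (key x' (hτX hx'τ))
    · have hτx : X.erase x = τ := by rw [hXτ, Finset.erase_insert hxX.2]
      rintro (rfl | rfl)
      · rw [hτx]; exact ⟨⟨hτc, hτD⟩, hτX⟩
      · refine ⟨⟨?_, ?_⟩, Finset.erase_subset _ _⟩
        · rw [Finset.card_erase_of_mem (hτX hx'τ)]; omega
        · rw [← hτD]
          apply Finset.Subset.antisymm
          · intro k hk
            obtain ⟨v, hv, rfl⟩ := Finset.mem_image.mp hk
            rw [hXτ, Finset.mem_erase, Finset.mem_insert] at hv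
            rcases hv with ⟨_, rfl | hv⟩
            · rw [← hcx']; exact Finset.mem_image_of_mem _ hx'τ
            · exact Finset.mem_image_of_mem _ hv
          · intro k hk
            obtain ⟨v, hv, rfl⟩ := Finset.mem_image.mp hk
            by_cases hvx : v = x'
            · rw [hvx, hcx']
              exact Finset.mem_image_of_mem _ (Finset.mem_erase.mpr ⟨hne, hxX.1⟩)
            · exact Finset.mem_image_of_mem _ (Finset.mem_erase.mpr ⟨hvx, hτX hv⟩)
  rw [hset, Finset.card_pair]
  · exact even_two
  · intro h
    have : x ∈ X.erase x' := Finset.mem_erase.mpr ⟨hne, hxX.1⟩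
    rw [← h] at this
    simp at this

/-- **Scarf's lemma**, for finitely many points with a slack point `s i` for every order. -/
theorem exists_isDominating_image_eq_univ [Nonempty I] {r : I → V → L}
    (hr : ∀ i, Function.Injective (r i)) {c : V → I} {s : I → V} (hcs : ∀ i, c (s i) = i)
    (hslack : ∀ i v, v ≠ s i → r i (s i) < r i v)
    (hout : ∀ i j v, v ∉ Set.range s → j ≠ i → r i v < r i (s j))
    (hV : ∃ v, v ∉ Set.range s) :
    ∃ X : Finset V, IsDominating r X ∧ X.image c = Finset.univ := by
  classical
  by_contra! hno
  obtain ⟨i₀⟩ := ‹Nonempty I›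
  set D : Finset I := Finset.univ.erase i₀ with hD
  have hDc : D.card + 1 = Fintype.card I := by
    rw [hD, Finset.card_erase_of_mem (Finset.mem_univ _), Finset.card_univ]
    have : 0 < Fintype.card I := Fintype.card_pos_iff.mpr ⟨i₀⟩
    omega
  -- If no dominating set carries all colours, every room has 0 or 2 doors. Every door lies in 0 or
  -- 2 rooms, except the all-slack door `τ₀`, which lies in exactly one: the two counts of
  -- incidences differ in parity.
  set rooms : Finset (Finset V) := Finset.univ.filter
    (fun X => X.card = D.card + 1 ∧ IsDominating r X) with hrooms
  set doors : Finset (Finset V) := Finset.univ.filter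
    (fun τ => τ.card = D.card ∧ τ.image c = D) with hdoors
  have hdc := Finset.sum_card_bipartiteAbove_eq_sum_card_bipartiteBelow (s := doors) (t := rooms)
    (fun τ X => τ ⊆ X)
  have heven : Even (∑ X ∈ rooms, (doors.bipartiteBelow (fun τ X => τ ⊆ X) X).card) := by
    refine Finset.even_sum _ fun X hX => ?_
    rw [hrooms, Finset.mem_filter] at hX
    rw [Finset.bipartiteBelow, hdoors, Finset.filter_filter]
    refine even_card_subset_image_eq hX.2.1 fun x _ i hi _ h => hno X hX.2.2 ?_
    rw [h]
    have : i = i₀ := by simpa [hD] using hi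
    rw [this, hD, Finset.insert_erase (Finset.mem_univ _)]
  set τ₀ : Finset V := D.image s with hτ₀
  have hsinj : Function.Injective s := fun i j h => by rw [← hcs i, h, hcs]
  have hτ₀mem : τ₀ ∈ doors := by
    rw [hdoors, Finset.mem_filter]
    refine ⟨Finset.mem_univ _, Finset.card_image_of_injective _ hsinj, ?_⟩
    rw [hτ₀, Finset.image_image]
    have : c ∘ s = id := funext hcs
    rw [this, Finset.image_id]
  have habove : ∀ τ ∈ doors, rooms.bipartiteAbove (fun τ X => τ ⊆ X) τ =
      (Finset.univ.filter (fun y => y ∉ τ ∧ IsDominating r (insert y τ))).image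
        (fun y => insert y τ) := by
    intro τ hτ
    rw [hdoors, Finset.mem_filter] at hτ
    ext X
    simp only [Finset.bipartiteAbove, hrooms, Finset.mem_filter, Finset.mem_univ, true_and,
      Finset.mem_image]
    constructor
    · rintro ⟨⟨hXc, hX⟩, hτX⟩
      obtain ⟨y, hy⟩ : ∃ y, X \ τ = {y} := by
        rw [← Finset.card_eq_one, Finset.card_sdiff_of_subset hτX]; omega
      have hyX : y ∈ X ∧ y ∉ τ := by
        rw [← Finset.mem_sdiff, hy]; simp
      have hXτ : insert y τ = X := by
        rw [← Finset.sdiff_union_of_subset hτX, hy]; rfl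
      exact ⟨y, ⟨hyX.2, hXτ ▸ hX⟩, hXτ⟩
    · rintro ⟨y, ⟨hy, hdom⟩, rfl⟩
      exact ⟨⟨by rw [Finset.card_insert_of_notMem hy, hτ.2.1], hdom⟩, Finset.subset_insert _ _⟩
  have hcardabove : ∀ τ ∈ doors, (rooms.bipartiteAbove (fun τ X => τ ⊆ X) τ).card =
      (Finset.univ.filter (fun y => y ∉ τ ∧ IsDominating r (insert y τ))).card := by
    intro τ hτ
    rw [habove τ hτ, Finset.card_image_of_injOn]
    intro y hy z hz h
    simp only [Finset.coe_filter, Finset.mem_univ, true_and, Set.mem_ofPred_eq] at hy hz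
    have : y ∈ insert z τ := by
      have h' : insert y τ = insert z τ := h
      rw [← h']; exact Finset.mem_insert_self _ _
    exact (Finset.mem_insert.mp this).resolve_right hy.1
  have hinner : ∀ τ ∈ doors.erase τ₀, Even (rooms.bipartiteAbove (fun τ X => τ ⊆ X) τ).card := by
    intro τ hτ
    obtain ⟨hne, hτd⟩ := Finset.mem_erase.mp hτ
    rw [hcardabove τ hτd]
    rw [hdoors, Finset.mem_filter] at hτd
    obtain ⟨-, hτc, hτD⟩ := hτd
    by_cases hdom : IsDominating r τ
    swap
    · have : Finset.univ.filter (fun y => y ∉ τ ∧ IsDominating r (insert y τ)) = ∅ :=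
        Finset.filter_eq_empty_iff.mpr fun y _ h => hdom (h.2.subset (Finset.subset_insert _ _))
      simp [this]
    -- A door made of slack points alone would be `τ₀`. A non-slack point lies below `s k` in every
    -- order other than `k`, as the pivot lemma needs.
    obtain ⟨v, hvτ, hv⟩ : ∃ v ∈ τ, v ∉ Set.range s := by
      by_contra! hall
      refine hne (Finset.eq_of_subset_of_card_le (fun v hv => ?_) ?_)
      · obtain ⟨i, rfl⟩ := hall v hv
        refine Finset.mem_image_of_mem _ ?_
        rw [← hτD, ← hcs i]
        simpa [hcs] using Finset.mem_image_of_mem c hv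
      · rw [hτ₀, Finset.card_image_of_injective _ hsinj, hτc]
    obtain ⟨a, b, hab, ha, hb, h⟩ := exists_pair_isDominating_insert hr ⟨v, hvτ⟩
      (by rw [hτc, hDc]) hdom fun k => ⟨s k, fun l hl => ⟨v, hvτ, hout l k v hv hl.symm⟩⟩
    have : Finset.univ.filter (fun y => y ∉ τ ∧ IsDominating r (insert y τ)) = {a, b} := by
      ext y
      simp only [Finset.mem_filter, Finset.mem_univ, true_and, Finset.mem_insert,
        Finset.mem_singleton]
      constructor
      · exact fun hy => (h y hy.1).mp hy.2
      · intro hy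
        have hyτ : y ∉ τ := by rcases hy with rfl | rfl <;> assumption
        exact ⟨hyτ, (h y hyτ).mpr hy⟩
    rw [this, Finset.card_pair hab]
    exact even_two
  have houter : (rooms.bipartiteAbove (fun τ X => τ ⊆ X) τ₀).card = 1 := by
    rw [hcardabove τ₀ hτ₀mem, Finset.card_eq_one]
    have hrange : ∀ v, v ∉ Set.range s → v ∉ τ₀ := fun v hv h => by
      obtain ⟨i, -, rfl⟩ := Finset.mem_image.mp h
      exact hv ⟨i, rfl⟩
    obtain ⟨w, hw⟩ := hV
    -- The only completion of `τ₀` is the non-slack point highest in the order `i₀`.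
    obtain ⟨x, hx, hmax⟩ := (Finset.univ.filter (fun v => v ∉ Set.range s)).exists_max_image
      (r i₀) ⟨w, by simpa using hw⟩
    rw [Finset.mem_filter] at hx
    have hxmax : ∀ v, v ∉ Set.range s → r i₀ v ≤ r i₀ x := fun v hv =>
      hmax v (Finset.mem_filter.mpr ⟨Finset.mem_univ _, hv⟩)
    have hsD : ∀ i, i ≠ i₀ → s i ∈ τ₀ := fun i hi =>
      Finset.mem_image_of_mem _ (by simp [hD, hi])
    have hle : ∀ v, v ∉ τ₀ → r i₀ v ≤ r i₀ x := by
      intro v hv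
      by_cases h : v ∈ Set.range s
      · obtain ⟨i, rfl⟩ := h
        have hi : i = i₀ := by_contra fun hi => hv (hsD i hi)
        subst hi
        by_cases hxs : x = s i
        · rw [hxs]
        · exact (hslack i x hxs).le
      · exact hxmax v h
    refine ⟨x, ?_⟩
    ext y
    simp only [Finset.mem_filter, Finset.mem_univ, true_and, Finset.mem_singleton]
    constructor
    · rintro ⟨hy, hdom⟩
      obtain ⟨i, hi⟩ := hdom x
      have hi₀ : i = i₀ := by
        by_contra h
        have h1 := hi (s i) (Finset.mem_insert_of_mem (hsD i h))
        exact absurd h1 (not_le.mpr (hslack i x fun h => hx.2 ⟨i, h.symm⟩))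
      subst hi₀
      exact hr i (le_antisymm (hle y hy) (hi y (Finset.mem_insert_self _ _)))
    · rintro rfl
      refine ⟨hrange _ hx.2, fun v => ?_⟩
      by_cases hv : v ∈ τ₀
      · obtain ⟨i, -, rfl⟩ := Finset.mem_image.mp hv
        refine ⟨i, fun z _ => ?_⟩
        by_cases hz : z = s i
        · rw [hz]
        · exact (hslack i z hz).le
      · refine ⟨i₀, fun z hz => ?_⟩
        rcases Finset.mem_insert.mp hz with rfl | hz
        · exact hle v hv
        · obtain ⟨j, hj, rfl⟩ := Finset.mem_image.mp hz
          exact (hle v hv).trans (hout i₀ j y hx.2 (Finset.ne_of_mem_erase hj)).le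
  rw [← hdc, ← Finset.add_sum_erase _ _ hτ₀mem, houter] at heven
  have := Finset.even_sum _ hinner
  rw [add_comm, Nat.even_add_one] at heven
  exact heven this

end Scarf

/-! ### A covering theorem on the simplex. -/

section CoveringSimplex

variable {I : Type*} [Fintype I] [DecidableEq I] [Nonempty I]

/-- Every colouring of the grid points of the simplex `∑ x = N` has a grid point which, for each
`i`, is near the face `x i = 0` or near a point of colour `i`. -/
theorem exists_grid_point_near_colors (N : ℕ) (c : (I → ℕ) → I) :
    ∃ x₀ : I → ℕ, ∑ i, x₀ i = N ∧ ∀ i, x₀ i ≤ Fintype.card I ∨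
      ∃ x : I → ℕ, ∑ i, x i = N ∧ c x = i ∧ ∀ j, |(x j : ℤ) - x₀ j| ≤ Fintype.card I := by
  classical
  let T := {x : I → ℕ // x ∈ Finset.piAntidiag Finset.univ N}
  have : Fintype T := inferInstanceAs (Fintype (Finset.piAntidiag Finset.univ N : Finset (I → ℕ)))
  have hsum : ∀ x : T, ∑ i, x.1 i = N := fun x => (Finset.mem_piAntidiag.mp x.2).1
  have hleN : ∀ (x : T) i, x.1 i ≤ N := fun x i => by
    refine le_of_le_of_eq ?_ (hsum x)
    exact Finset.single_le_sum (f := x.1) (fun _ _ => Nat.zero_le _) (Finset.mem_univ i)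
  have mkT : ∀ x : I → ℕ, ∑ i, x i = N → ∃ y : T, y.1 = x := fun x hx =>
    ⟨⟨x, Finset.mem_piAntidiag.mpr ⟨hx, fun _ _ => Finset.mem_univ _⟩⟩, rfl⟩
  -- Grid coordinates lie in [0, N], so -1 and N + 1 put the slack point of `i` at the bottom of
  -- order `i` and above all grid points in the other orders. The lexicographic second entry in `r`
  -- breaks ties.
  let coord : I → T ⊕ I → ℤ := fun i =>
    Sum.elim (fun x => (x.1 i : ℤ)) (fun j => if j = i then -1 else N + 1)
  let e := Fintype.equivFin (T ⊕ I)
  let r : I → T ⊕ I → ℤ ×ₗ Fin (Fintype.card (T ⊕ I)) := fun i v => toLex (coord i v, e v)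
  have hlt : ∀ i v w, coord i v < coord i w → r i v < r i w := fun i v w h =>
    Prod.Lex.toLex_lt_toLex.mpr (Or.inl h)
  have hle : ∀ i v w, r i v ≤ r i w → coord i v ≤ coord i w := fun i v w h =>
    not_lt.mp fun h' => absurd (hlt i w v h') (not_lt.mpr h)
  obtain ⟨i₀⟩ := ‹Nonempty I›
  have mkGe : ∀ t : I → ℕ, ∑ i, t i ≤ N → ∃ y : T, ∀ i, t i ≤ y.1 i := by
    intro t ht
    obtain ⟨y, hy⟩ := mkT (t + Pi.single i₀ (N - ∑ i, t i)) (by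
      simp only [Pi.add_apply, Finset.sum_add_distrib, Finset.sum_pi_single', Finset.mem_univ,
        if_true]
      omega)
    exact ⟨y, fun i => by rw [hy]; simp⟩
  have : Nonempty I := ⟨i₀⟩
  obtain ⟨X, hX, hXc⟩ := exists_isDominating_image_eq_univ (r := r)
    (fun i v w h => e.injective (congrArg Prod.snd (toLex.injective h)))
    (c := Sum.elim (fun x => c x.1) id) (s := Sum.inr) (fun i => rfl)
    (by
      rintro i (x | j) hv <;> apply hlt
      · simp only [coord, Sum.elim_inl, Sum.elim_inr, if_true]; omega
      · have : j ≠ i := fun h => hv (by rw [h])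
        simp only [coord, Sum.elim_inr, if_true, if_neg this]; omega)
    (by
      rintro i j (x | k) hv hji
      · apply hlt
        have := hleN x i
        simp only [coord, Sum.elim_inl, Sum.elim_inr, if_neg hji]; omega
      · exact absurd ⟨k, rfl⟩ hv)
    (by
      obtain ⟨y, -⟩ := mkGe 0 (by simp)
      exact ⟨Sum.inl y, by simp⟩)
  have hdom : ∀ y : T, ∃ i, Sum.inr i ∉ X ∧ ∀ x : T, Sum.inl x ∈ X → y.1 i ≤ x.1 i := by
    intro y
    obtain ⟨i, hi⟩ := hX (Sum.inl y)
    refine ⟨i, fun h => ?_, fun x hx => ?_⟩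
    · have := hle _ _ _ (hi _ h)
      simp only [coord, Sum.elim_inl, Sum.elim_inr, if_true] at this
      omega
    · have := hle _ _ _ (hi _ hx)
      simpa [coord] using this
  have hcol : ∀ i, Sum.inr i ∉ X → ∃ x : T, Sum.inl x ∈ X ∧ c x.1 = i := by
    intro i hi
    obtain ⟨v, hv, hvi⟩ := Finset.mem_image.mp (hXc ▸ Finset.mem_univ i)
    rcases v with x | j
    · exact ⟨x, hv, hvi⟩
    · exact absurd hv (by rwa [show j = i from hvi])
  obtain ⟨x₀, hx₀⟩ : ∃ x : T, Sum.inl x ∈ X := by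
    obtain ⟨y, -⟩ := mkGe 0 (by simp)
    obtain ⟨i, hi, -⟩ := hdom y
    obtain ⟨x, hx, -⟩ := hcol i hi
    exact ⟨x, hx⟩
  have hmin : ∀ i, ∃ x : T, Sum.inl x ∈ X ∧ ∀ x' : T, Sum.inl x' ∈ X → x.1 i ≤ x'.1 i := by
    intro i
    obtain ⟨x, hx, h⟩ := (Finset.univ.filter (fun x : T => Sum.inl x ∈ X)).exists_min_image
      (fun x => x.1 i) ⟨x₀, by simpa using hx₀⟩
    exact ⟨x, by simpa using hx, fun x' hx' => h x' (by simpa using hx')⟩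
  choose xm hxm hxmle using hmin
  let m : I → ℕ := fun i => if Sum.inr i ∈ X then 0 else (xm i).1 i
  have hm : ∀ x : T, Sum.inl x ∈ X → ∀ i, m i ≤ x.1 i := by
    intro x hx i
    by_cases h : Sum.inr i ∈ X
    · simp [m, h]
    · simpa [m, h] using hxmle i x hx
  -- Otherwise some grid point exceeds `m` in every coordinate, against domination. Hence all grid
  -- points of `X` lie within `Fintype.card I` of `m`.
  have hmN : N < ∑ i, m i + Fintype.card I := by
    by_contra! hcon
    obtain ⟨y, hy⟩ := mkGe (fun i => m i + 1) (by
      simpa [Finset.sum_add_distrib] using hcon)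
    obtain ⟨i, hi, h⟩ := hdom y
    have h1 := h _ (hxm i)
    have h2 := hy i
    simp only [m, if_neg hi] at h2
    omega
  have hup : ∀ x : T, Sum.inl x ∈ X → ∀ i, x.1 i ≤ m i + Fintype.card I := by
    intro x hx i
    have h1 : ∑ j, (x.1 j - m j) + ∑ j, m j = N := by
      rw [← Finset.sum_add_distrib]
      refine Eq.trans ?_ (hsum x)
      exact Finset.sum_congr rfl fun j _ => Nat.sub_add_cancel (hm x hx j)
    have h2 : x.1 i - m i ≤ ∑ j, (x.1 j - m j) :=
      Finset.single_le_sum (f := fun j => x.1 j - m j) (fun _ _ => Nat.zero_le _)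
        (Finset.mem_univ i)
    omega
  refine ⟨x₀.1, hsum x₀, fun i => ?_⟩
  by_cases hi : Sum.inr i ∈ X
  · left
    simpa [m, hi] using hup x₀ hx₀ i
  · right
    obtain ⟨x, hx, hxi⟩ := hcol i hi
    refine ⟨x.1, hsum x, hxi, fun j => ?_⟩
    have h1 := hm x hx j
    have h2 := hup x hx j
    have h3 := hm x₀ hx₀ j
    have h4 := hup x₀ hx₀ j
    rw [abs_le]
    constructor <;> omega

open Filter Topology in
/-- A **Knaster–Kuratowski–Mazurkiewicz** type theorem: if closed sets `F i` cover the standard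
simplex, then some point `z` of the simplex lies in each `F i` with `z i ≠ 0`. -/
theorem exists_mem_stdSimplex_forall_pos_mem {F : I → Set (I → ℝ)} (hF : ∀ i, IsClosed (F i))
    (hcover : ∀ x ∈ stdSimplex ℝ I, ∃ i, x ∈ F i) :
    ∃ z ∈ stdSimplex ℝ I, ∀ i, 0 < z i → z ∈ F i := by
  classical
  let p : ℕ → (I → ℕ) → I → ℝ := fun N x i => (x i : ℝ) / (N + 1 : ℕ)
  have hp : ∀ N x, ∑ i, x i = N + 1 → p N x ∈ stdSimplex ℝ I := by
    intro N x hx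
    refine ⟨fun i => by positivity, ?_⟩
    simp only [p]
    rw [← Finset.sum_div, ← Nat.cast_sum, hx, div_self]
    exact_mod_cast Nat.succ_ne_zero N
  have hcol : ∀ N, ∃ c : (I → ℕ) → I, ∀ x, ∑ i, x i = N + 1 → p N x ∈ F (c x) := by
    intro N
    have : ∀ x : I → ℕ, ∃ i, ∑ i, x i = N + 1 → p N x ∈ F i := by
      intro x
      by_cases hx : ∑ i, x i = N + 1
      · exact (hcover _ (hp N x hx)).imp fun i hi _ => hi
      · exact ⟨Classical.arbitrary I, fun h => absurd h hx⟩
    choose c hc using this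
    exact ⟨c, hc⟩
  choose c hc using hcol
  choose x hxsum hx using fun N => exists_grid_point_near_colors (N + 1) (c N)
  obtain ⟨z, hz, φ, hφ, hlim⟩ := (isCompact_stdSimplex ℝ I).tendsto_subseq
    (x := fun N => p N (x N)) (fun N => hp N _ (hxsum N))
  refine ⟨z, hz, fun i hi => ?_⟩
  have hsmall : Tendsto (fun k => (Fintype.card I : ℝ) / (φ k + 1 : ℕ)) atTop (𝓝 0) :=
    (tendsto_const_div_atTop_nhds_zero_nat (Fintype.card I : ℝ)).comp
      ((tendsto_add_atTop_nat 1).comp hφ.tendsto_atTop)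
  have hlimi : Tendsto (fun k => p (φ k) (x (φ k)) i) atTop (𝓝 (z i)) :=
    (tendsto_pi_nhds.mp hlim) i
  rw [← (hF i).closure_eq, Metric.mem_closure_iff]
  intro ε hε
  -- As `z i > 0`, the near-face alternative eventually fails, leaving nearby points of colour `i`.
  have h1 := hsmall.eventually_lt hlimi hi
  have h2 := hsmall.eventually_lt_const (half_pos hε)
  have h3 := (Metric.tendsto_nhds.mp hlim) (ε / 2) (half_pos hε)
  obtain ⟨k, hk1, hk2, hk3⟩ := (h1.and (h2.and h3)).exists
  have hpos : (0 : ℝ) < (φ k + 1 : ℕ) := by exact_mod_cast Nat.succ_pos _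
  rcases hx (φ k) i with h | ⟨w, hwsum, hwi, hw⟩
  · have h' : p (φ k) (x (φ k)) i ≤ (Fintype.card I : ℝ) / (φ k + 1 : ℕ) :=
      div_le_div_of_nonneg_right (by exact_mod_cast h) hpos.le
    exact absurd hk1 (not_lt.mpr h')
  · refine ⟨p (φ k) w, hwi ▸ hc (φ k) w hwsum, ?_⟩
    have hd : dist (p (φ k) (x (φ k))) (p (φ k) w) ≤ (Fintype.card I : ℝ) / (φ k + 1 : ℕ) := by
      rw [dist_pi_le_iff (by positivity)]
      intro j
      rw [dist_comm, Real.dist_eq]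
      simp only [p]
      rw [← sub_div, abs_div, abs_of_pos hpos]
      exact div_le_div_of_nonneg_right (by exact_mod_cast hw j) hpos.le
    have htri := dist_triangle_left z (p (φ k) w) (p (φ k) (x (φ k)))
    have hk3' : dist (p (φ k) (x (φ k))) z < ε / 2 := hk3
    linarith

end CoveringSimplex

/-! ### Nash's theorem for finite games. -/

section FiniteGame

variable {ι : Type*} [Fintype ι] [DecidableEq ι] {S : ι → Type*} [∀ i, Fintype (S i)]

/-- The multilinear extension of the payoff function `v` to (possibly unnormalised) mixed
strategies. -/
noncomputable def multilinearPayoff (v : (∀ i, S i) → ℝ) (σ : ∀ i, S i → ℝ) : ℝ :=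
  ∑ a : (∀ i, S i), (∏ j, σ j (a j)) * v a

omit [∀ i, Fintype (S i)] in
theorem prod_update_apply (σ : ∀ i, S i → ℝ) (i : ι) (ρ : S i → ℝ) (a : ∀ i, S i) :
    ∏ j, Function.update σ i ρ j (a j) = ρ (a i) * ∏ j ∈ Finset.univ.erase i, σ j (a j) := by
  rw [← Finset.mul_prod_erase _ _ (Finset.mem_univ i), Function.update_self]
  congr 1
  exact Finset.prod_congr rfl fun j hj => by
    rw [Function.update_of_ne (Finset.ne_of_mem_erase hj)]

/-- Linearity in one player's strategy reduces mixed deviations to pure ones. -/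
theorem multilinearPayoff_update [∀ i, DecidableEq (S i)] (v : (∀ i, S i) → ℝ)
    (σ : ∀ i, S i → ℝ) (i : ι) (ρ : S i → ℝ) :
    multilinearPayoff v (Function.update σ i ρ) =
      ∑ b, ρ b * multilinearPayoff v (Function.update σ i (Pi.single b 1)) := by
  simp only [multilinearPayoff, prod_update_apply, Finset.mul_sum]
  rw [Finset.sum_comm]
  refine Finset.sum_congr rfl fun a _ => ?_
  rw [Finset.sum_eq_single (a i)]
  · simp [mul_assoc]
  · intro b _ hb
    rw [Pi.single_eq_of_ne hb.symm]
    ring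
  · exact fun h => absurd (Finset.mem_univ _) h

theorem continuous_multilinearPayoff (v : (∀ i, S i) → ℝ) :
    Continuous (multilinearPayoff v) := by
  unfold multilinearPayoff
  fun_prop

/-- **Nash's theorem** for finite games. -/
theorem exists_mixed_equilibrium [∀ i, Nonempty (S i)] (v : ι → (∀ i, S i) → ℝ) :
    ∃ σ : ∀ i, S i → ℝ, (∀ i, σ i ∈ stdSimplex ℝ (S i)) ∧
      ∀ i, ∀ ρ ∈ stdSimplex ℝ (S i),
        multilinearPayoff (v i) (Function.update σ i ρ) ≤ multilinearPayoff (v i) σ := by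
  classical
  rcases isEmpty_or_nonempty ι with hι | hι
  · exact ⟨fun i => isEmptyElim i, fun i => isEmptyElim i, fun i => isEmptyElim i⟩
  let n : ℝ := Fintype.card ι
  have hn : 0 < n := by
    have : 0 < Fintype.card ι := Fintype.card_pos
    exact Nat.cast_pos.mpr this
  have : Nonempty (Σ i, S i) := ⟨⟨hι.some, Classical.arbitrary _⟩⟩
  let mass : ι → ((Σ i, S i) → ℝ) → ℝ := fun i x => ∑ a, x ⟨i, a⟩
  -- The factor `n` normalises each player's weights only where all masses equal 1/n; elsewhere
  -- payoffs are evaluated on unnormalised strategies.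
  let prof : ((Σ i, S i) → ℝ) → ∀ i, S i → ℝ := fun x i a => n * x ⟨i, a⟩
  let W : ((Σ i, S i) → ℝ) → ∀ i, S i → ℝ := fun x i b =>
    multilinearPayoff (v i) (Function.update (prof x) i (Pi.single b 1))
  have hmass : ∀ i, Continuous (mass i) := fun i => by fun_prop
  have hprof : Continuous prof := by fun_prop
  have hW : ∀ i b, Continuous fun x => W x i b := fun i b =>
    (continuous_multilinearPayoff _).comp (hprof.update i continuous_const)
  obtain ⟨z, ⟨hz0, hz1⟩, hz⟩ := exists_mem_stdSimplex_forall_pos_mem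
    (F := fun j : Σ i, S i =>
      {x | (∀ k, mass j.1 x ≤ mass k x) ∧ ∀ b, W x j.1 b ≤ W x j.1 j.2})
    (fun j => by
      simp only [Set.ofPred_and, Set.ofPred_forall]
      exact (isClosed_iInter fun k => isClosed_le (hmass _) (hmass k)).inter
        (isClosed_iInter fun b => isClosed_le (hW _ b) (hW _ _)))
    (fun x _ => by
      obtain ⟨i, hi⟩ := Finite.exists_min (fun k => mass k x)
      obtain ⟨a, ha⟩ := Finite.exists_max (W x i)
      exact ⟨⟨i, a⟩, hi, ha⟩)
  have hsum : ∑ k, mass k z = 1 := by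
    rw [← hz1, Fintype.sum_sigma]
  have hposmass : ∀ k, 0 < mass k z → ∃ b, 0 < z ⟨k, b⟩ := by
    intro k hk
    by_contra! hcon
    exact absurd hk (not_lt.mpr (Finset.sum_nonpos fun b _ => hcon b))
  obtain ⟨i, hi⟩ : ∃ i, 0 < mass i z := by
    by_contra! hcon
    have := Finset.sum_nonpos fun k (_ : k ∈ Finset.univ) => hcon k
    linarith
  obtain ⟨a, ha⟩ := hposmass i hi
  have hmin := (hz _ ha).1
  -- The least mass is positive, so every player has an action of positive weight and is itself of
  -- least mass.
  have heq : ∀ k, mass k z = mass i z := by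
    intro k
    obtain ⟨b, hb⟩ := hposmass k (hi.trans_le (hmin k))
    exact le_antisymm ((hz _ hb).1 i) (hmin k)
  have hnmass : ∀ k, n * mass k z = 1 := by
    intro k
    rw [heq k, ← hsum, Finset.sum_congr rfl fun k _ => heq k]
    simp [n]
  have hσ : ∀ k, prof z k ∈ stdSimplex ℝ (S k) := by
    refine fun k => ⟨fun b => mul_nonneg hn.le (hz0 _), ?_⟩
    rw [← hnmass k, Finset.mul_sum]
  refine ⟨prof z, hσ, fun k ρ hρ => ?_⟩
  obtain ⟨b, hb⟩ := hposmass k (hi.trans_le (hmin k))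
  have hbest := (hz _ hb).2
  calc multilinearPayoff (v k) (Function.update (prof z) k ρ)
      = ∑ d, ρ d * W z k d := multilinearPayoff_update _ _ _ _
    _ ≤ ∑ d, ρ d * W z k b :=
        Finset.sum_le_sum fun d _ => mul_le_mul_of_nonneg_left (hbest d) (hρ.1 d)
    _ = ∑ d, prof z k d * W z k b := by
        rw [← Finset.sum_mul, ← Finset.sum_mul, hρ.2, (hσ k).2]
    _ = ∑ d, prof z k d * W z k d := by
        -- Unplayed actions contribute zero; played ones are best replies.
        refine Finset.sum_congr rfl fun d _ => ?_
        rcases (hz0 ⟨k, d⟩).eq_or_lt with h | h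
        · simp [prof, ← h]
        · rw [le_antisymm ((hz _ h).2 b) (hbest d)]
    _ = multilinearPayoff (v k) (prof z) := by
        rw [← multilinearPayoff_update, Function.update_eq_self]

end FiniteGame

/-! ### The compensation game as a finite game. -/

theorem lemma1 {ι : Type*} [Fintype ι] [DecidableEq ι] (G : VarGame ι) (F : PTFraming ι) :
    ∃ σ : ∀ i, G.A i → ℝ, G.IsMixedNash (G.expectedPT F) σ := by
  have : ∀ i, Nonempty (G.A i) := fun i => (G.A_nonempty i).to_subtype
  exact exists_mixed_equilibrium (S := fun i => G.A i)
    fun i a => G.ptUtility F i fun j => (a j : ℝ)
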